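/- Let $G$ be a finite group and let $\pi$ be a non-empty set of primes, with complement $\pi'$ in the set of all primes. A positive integer is a $\pi$-number (a $\pi'$-number) if all its prime divisors lie in $\pi$ (in $\pi'$); a Hall $\pi$-subgroup of a finite group is a subgroup whose order is a $\pi$-number and whose index is a $\pi'$-number. For subgroups $A,B$ of $G$ and a non-empty subset $X\subseteq G$, say that $A$ is $X$-permutable with $B$ if $AB^x=B^xA$ for some $x\in X$, where $B^x=x^{-1}Bx$. **Theorem 5.2.** Let $X$ be a normal subgroup of $G$ that has a nilpotent Hall $\pi$-subgroup. Suppose that $G$ has a subgroup series $$1=H_0<H_1\le\cdots\le H_{t-1}\le H_t=G\qquad(t\ge 1)$$ such that, for every $i=0,1,\ldots,t-1$, the index $|H_{i+1}:H_i|$ is divisible by at most one prime in $\pi$. Suppose that $G$ has a subgroup $T$ such that $H_1T=G$ and $|G:T|$ is a $\pi'$-number. If $H_i$ is $X$-permutable with each Sylow subgroup of $T$ for all $i=1,\ldots,t$, then $G$ has a soluble Hall $\pi$-subgroup, that is, $G$ is an $E^S_\pi$-group. -/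

import Mathlib

open scoped Pointwise

/-- The set `π'` of all primes outside `π`. -/
def primeCompl (π : Set ℕ) : Set ℕ := {p | p.Prime ∧ p ∉ π}

/-- `n` is a `π`-number: `n` is coprime to every prime in `π'`. -/
def IsPiNumber (π : Set ℕ) (n : ℕ) : Prop := ∀ p ∈ primeCompl π, Nat.Coprime n p

/-- `H` is a Hall `π`-subgroup of `G`: the order of `H` is a `π`-number and its index is a
`π'`-number. (Used for finite `G` only.) -/
def IsHallPiSubgroup {G : Type*} [Group G] (π : Set ℕ) (H : Subgroup G) : Prop :=
  IsPiNumber π (Nat.card H) ∧ IsPiNumber (primeCompl π) H.index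

/-- `G` is an `E^S_π`-group: it has a soluble Hall `π`-subgroup. -/
def IsESPiGroup (π : Set ℕ) (G : Type*) [Group G] : Prop :=
  ∃ H : Subgroup G, IsHallPiSubgroup π H ∧ Group.IsSolvable H

/-- `G` is an `E^N_π`-group: it has a nilpotent Hall `π`-subgroup. -/
def IsENPiGroup (π : Set ℕ) (G : Type*) [Group G] : Prop :=
  ∃ H : Subgroup G, IsHallPiSubgroup π H ∧ Group.IsNilpotent H

/-- `A` permutes with `B`: `AB = BA` as sets of products. -/
def PermutesWith {G : Type*} [Group G] (A B : Subgroup G) : Prop :=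
  (A : Set G) * (B : Set G) = (B : Set G) * (A : Set G)

/-- The conjugate `B^x = x⁻¹ B x`. -/
def conjSubgroup {G : Type*} [Group G] (B : Subgroup G) (x : G) : Subgroup G :=
  B.map (MulAut.conj x⁻¹).toMonoidHom

/-- `A` is `X`-permutable with `B`: `A B^x = B^x A` for some `x ∈ X`. -/
def XPermutesWith {G : Type*} [Group G] (X : Set G) (A B : Subgroup G) : Prop :=
  ∃ x ∈ X, PermutesWith A (conjSubgroup B x)

/-! Work in `G ⧸ X`: an extension of a group with a nilpotent Hall `π`-subgroup by a group with a
soluble one has a soluble one (`IsESPiGroup.of_isENPiGroup_ker`), so the quotient suffices. Its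
subgroup `T.map f` has `π'`-index, so `T.map f` suffices.

Modulo `X` the conjugating elements become trivial, so the image of each `H i`, cut down to `T.map
f`, permutes with every Sylow subgroup of `T.map f` and is subnormal there by Kegel's theorem. Since
`H 1` and `T` factorise `G`, the indices of the new series divide the old ones.

For a subnormal series (`IsESPiGroup.of_subnormal_series`), the first term lies in a normal subgroup
whose order involves no further primes of `π`. That subgroup has a trivial or Sylow Hall
`π`-subgroup; factor it out, induct on the length, and apply the extension theorem again. The
extension theorem is a Frattini argument based on Wielandt's conjugacy theorem, followed by
Schur–Zassenhaus. -/

namespace Subgroup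

variable {G : Type*} [Group G]

/-! ### Permuting subgroups and relative indices. -/

lemma permutesWith_iff {A B : Subgroup G} :
    PermutesWith A B ↔ ∀ a ∈ A, ∀ b ∈ B, ∃ a' ∈ A, ∃ b' ∈ B, b * a = a' * b' := by
  constructor
  · intro h a ha b hb
    have : b * a ∈ (A : Set G) * (B : Set G) := by
      rw [PermutesWith] at h
      rw [h]; exact Set.mul_mem_mul hb ha
    obtain ⟨a', ha', b', hb', e⟩ := this
    exact ⟨a', ha', b', hb', e.symm⟩
  · intro h
    apply Set.Subset.antisymm
    · rintro _ ⟨a, ha, b, hb, rfl⟩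
      obtain ⟨a', ha', b', hb', e⟩ := h a⁻¹ (A.inv_mem ha) b⁻¹ (B.inv_mem hb)
      refine ⟨b'⁻¹, B.inv_mem hb', a'⁻¹, A.inv_mem ha', ?_⟩
      have := congrArg (·⁻¹) e
      simpa using this.symm
    · rintro _ ⟨b, hb, a, ha, rfl⟩
      obtain ⟨a', ha', b', hb', e⟩ := h a ha b hb
      exact ⟨a', ha', b', hb', e.symm⟩

lemma _root_.PermutesWith.symm {A B : Subgroup G} (h : PermutesWith A B) : PermutesWith B A :=
  Eq.symm h

lemma _root_.PermutesWith.inf_right {A B L : Subgroup G} (h : PermutesWith A B) (hL : A ≤ L) :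
    PermutesWith A (B ⊓ L) := by
  rw [permutesWith_iff] at h ⊢
  intro a ha b hb
  obtain ⟨a', ha', b', hb', e⟩ := h a ha b hb.1
  refine ⟨a', ha', b', ⟨hb', ?_⟩, e⟩
  have : b' = a'⁻¹ * (b * a) := by rw [e]; group
  rw [this]
  exact L.mul_mem (L.inv_mem (hL ha')) (L.mul_mem hb.2 (hL ha))

lemma _root_.PermutesWith.map {A B : Subgroup G} (h : PermutesWith A B) {G' : Type*} [Group G']
    (f : G →* G') : PermutesWith (A.map f) (B.map f) := by
  have := congrArg (f '' ·) h
  simpa [PermutesWith, Set.image_mul] using this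

lemma _root_.PermutesWith.smul {A B : Subgroup G} (h : PermutesWith A B) (g : G) :
    PermutesWith (MulAut.conj g • A) (MulAut.conj g • B) :=
  PermutesWith.map h (MulAut.conj g).toMonoidHom

lemma _root_.PermutesWith.sup_left {A A' B : Subgroup G} (h : PermutesWith A B)
    (h' : PermutesWith A' B) : PermutesWith (A ⊔ A') B := by
  rw [permutesWith_iff] at h h' ⊢
  have gen : ∀ x, x ∈ A ∨ x ∈ A' → ∀ b ∈ B, ∃ a' ∈ A ⊔ A', ∃ b' ∈ B, b * x = a' * b' := by
    rintro x (hx | hx) b hb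
    · obtain ⟨a', ha', e⟩ := h x hx b hb
      exact ⟨a', le_sup_left (a := A) ha', e⟩
    · obtain ⟨a', ha', e⟩ := h' x hx b hb
      exact ⟨a', le_sup_right (a := A) ha', e⟩
  intro a ha
  rw [sup_eq_closure] at ha
  induction ha using closure_induction'' with
  | mem x hx => exact gen x hx
  | inv_mem x hx => exact gen x⁻¹ (by simpa using hx)
  | one => exact fun b hb => ⟨1, one_mem _, b, hb, by simp⟩
  | mul x y _ _ hx hy =>
    intro b hb
    obtain ⟨a₁, ha₁, b₁, hb₁, e₁⟩ := hx b hb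
    obtain ⟨a₂, ha₂, b₂, hb₂, e₂⟩ := hy b₁ hb₁
    exact ⟨a₁ * a₂, mul_mem ha₁ ha₂, b₂, hb₂, by rw [← mul_assoc, e₁, mul_assoc, e₂, mul_assoc]⟩

lemma _root_.PermutesWith.exists_mul_of_mem_sup {A B : Subgroup G} (h : PermutesWith A B) {x : G}
    (hx : x ∈ A ⊔ B) : ∃ b ∈ B, ∃ a ∈ A, x = b * a := by
  have hgen : ∀ x, x ∈ A ∨ x ∈ B → ∀ b ∈ B, ∀ a ∈ A, ∃ b' ∈ B, ∃ a' ∈ A, x * (b * a) = b' * a' := by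
    rintro x (hx | hx) b hb a ha
    · obtain ⟨b', hb', a', ha', e⟩ := permutesWith_iff.1 (PermutesWith.symm h) b hb x hx
      exact ⟨b', hb', a' * a, mul_mem ha' ha, by rw [← mul_assoc, e, mul_assoc]⟩
    · exact ⟨x * b, mul_mem hx hb, a, ha, by rw [mul_assoc]⟩
  rw [sup_eq_closure] at hx
  induction hx using closure_induction_left with
  | one => exact ⟨1, one_mem _, 1, one_mem _, by simp⟩
  | mul_left x hx y _ ih =>
    obtain ⟨b, hb, a, ha, rfl⟩ := ih
    exact hgen x hx b hb a ha
  | inv_mul_cancel x hx y _ ih =>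
    obtain ⟨b, hb, a, ha, rfl⟩ := ih
    exact hgen x⁻¹ (by simpa using hx) b hb a ha

/-- The index of `A` relative to `D` is the size of the `D`-orbit of the trivial coset in `G ⧸ A`;
when `C ⊆ BA`, the groups `B` and `C` have the same orbit. -/
lemma relIndex_eq_of_forall_exists_mul {A B C : Subgroup G} (hBC : B ≤ C)
    (h : ∀ x ∈ C, ∃ b ∈ B, ∃ a ∈ A, x = b * a) : A.relIndex B = A.relIndex C := by
  have hs (D : Subgroup G) (x : D) : x • (QuotientGroup.mk 1 : G ⧸ A) = QuotientGroup.mk (x : G) :=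
    congrArg QuotientGroup.mk (mul_one (x : G))
  have key (D : Subgroup G) : A.relIndex D =
      (MulAction.orbit D (QuotientGroup.mk 1 : G ⧸ A)).ncard := by
    rw [← MulAction.index_stabilizer, relIndex]
    congr 1
    ext x
    rw [mem_subgroupOf, MulAction.mem_stabilizer_iff, hs, eq_comm, QuotientGroup.eq]
    simp
  rw [key, key]
  congr 1
  ext y
  simp only [MulAction.mem_orbit_iff, hs, Subtype.exists, exists_prop]
  constructor
  · rintro ⟨b, hb, rfl⟩
    exact ⟨b, hBC hb, rfl⟩
  · rintro ⟨x, hx, rfl⟩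
    obtain ⟨b, hb, a, ha, rfl⟩ := h x hx
    exact ⟨b, hb, by rw [QuotientGroup.eq]; simpa using ha⟩

lemma _root_.PermutesWith.relIndex_sup {A B : Subgroup G} (h : PermutesWith A B) :
    A.relIndex (A ⊔ B) = A.relIndex B :=
  (relIndex_eq_of_forall_exists_mul le_sup_right
    fun _ hx => PermutesWith.exists_mul_of_mem_sup h hx).symm

/-! ### Kegel's theorem on S-permutable subgroups. -/

lemma eq_top_of_forall_exists_sylow_le [Finite G] {K : Subgroup G}
    (h : ∀ p, p.Prime → ∃ P : Sylow p G, (P : Subgroup G) ≤ K) : K = ⊤ := by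
  rw [← index_eq_one]
  by_contra hne
  obtain ⟨p, hp, hpK⟩ := Nat.exists_prime_and_dvd hne
  obtain ⟨P, hP⟩ := h p hp
  have := Fact.mk hp
  exact P.not_dvd_index (hpK.trans (index_dvd_of_le hP))

lemma isSubnormal_of_isNilpotent [Finite G] [Group.IsNilpotent G] (H : Subgroup G) :
    H.IsSubnormal := by
  induction hn : H.index using Nat.strong_induction_on generalizing H with
  | _ n ih =>
    rcases eq_or_ne H ⊤ with rfl | hH
    · exact .top
    · have hlt := Group.normalizerCondition_of_isNilpotent H hH.lt_top
      refine .step H _ hlt.le (ih _ ?_ _ rfl) normal_in_normalizer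
      exact hn ▸ index_strictAnti hlt

/-- `A` permutes with every Sylow subgroup of `G`. -/
def IsSPermutable (A : Subgroup G) : Prop :=
  ∀ p : ℕ, p.Prime → ∀ P : Sylow p G, PermutesWith A P

lemma IsSPermutable.smul {A : Subgroup G} (h : A.IsSPermutable) (g : G) :
    (MulAut.conj g • A).IsSPermutable := by
  intro p hp P
  have := (h p hp (g⁻¹ • P)).smul g
  rwa [← Sylow.coe_subgroup_smul, smul_inv_smul] at this

lemma IsSPermutable.sup {A B : Subgroup G} (hA : A.IsSPermutable) (hB : B.IsSPermutable) :
    (A ⊔ B).IsSPermutable :=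
  fun p hp P => (hA p hp P).sup_left (hB p hp P)

/-- A Sylow subgroup of `B` is `P ⊓ B` with `P` Sylow in `G`, and Dedekind's law applies because `A
≤ B`. -/
lemma IsSPermutable.permutesWith_map_subtype {A B : Subgroup G} (hA : A.IsSPermutable)
    (hAB : A ≤ B) {p : ℕ} (hp : p.Prime) (Q : Sylow p B) :
    PermutesWith A ((Q : Subgroup B).map B.subtype) := by
  obtain ⟨P, hP⟩ := Q.exists_comap_subtype_eq
  rw [← hP, ← subgroupOf, subgroupOf_map_subtype]
  exact (hA p hp P).inf_right hAB

lemma mem_normalizer_iff_conj_smul_eq {H : Subgroup G} {g : G} :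
    g ∈ normalizer (H : Set G) ↔ MulAut.conj g • H = H :=
  mem_normalizer_iff_map_conj_eq

lemma mem_normalizer_iff_conj_smul_le [Finite G] {H : Subgroup G} {g : G} :
    g ∈ normalizer (H : Set G) ↔ MulAut.conj g • H ≤ H := by
  rw [mem_normalizer_iff_conj_smul_eq]
  refine ⟨fun h => h.le, fun h => eq_of_le_of_card_ge h ?_⟩
  exact (Nat.card_congr (equivSMul (MulAut.conj g) H).toEquiv).le

/-- Conjugates of Sylow subgroups are Sylow, so the normal core of `A` already contains all of them
for `q ≠ p`. The quotient by the core is a `p`-group, where every subgroup is subnormal. -/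
lemma isSubnormal_of_forall_sylow_le [Finite G] {A : Subgroup G} {p : ℕ} (hp : p.Prime)
    (h : ∀ q, q.Prime → q ≠ p → ∀ R : Sylow q G, (R : Subgroup G) ≤ A) : A.IsSubnormal := by
  have := Fact.mk hp
  have hR : ∀ q, q.Prime → q ≠ p → ∀ R : Sylow q G, (R : Subgroup G) ≤ A.normalCore := by
    intro q hq hqp R x hx g
    refine h q hq hqp (g • R) ?_
    exact smul_mem_pointwise_smul x (MulAut.conj g) (R : Subgroup G) hx
  have hcard : ∃ k, Nat.card (G ⧸ A.normalCore) = p ^ k := by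
    refine ⟨_, Nat.eq_prime_pow_of_unique_prime_dvd Nat.card_pos.ne' ?_⟩
    intro q hq hqd
    by_contra hqp
    have := Fact.mk hq
    obtain ⟨R⟩ : Nonempty (Sylow q G) := inferInstance
    rw [← index_eq_card] at hqd
    exact R.not_dvd_index (hqd.trans (index_dvd_of_le (hR q hq hqp R)))
  have : Group.IsNilpotent (G ⧸ A.normalCore) := (IsPGroup.iff_card.2 hcard).isNilpotent
  have hs := (isSubnormal_of_isNilpotent (A.map (QuotientGroup.mk' A.normalCore))).comap
    (QuotientGroup.mk' A.normalCore)
  rwa [comap_map_eq, QuotientGroup.ker_mk', sup_eq_left.2 (normalCore_le A)] at hs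

/-- Permuting with `P` makes `|B : A|` a power of `p`. Permuting with a Sylow `q`-subgroup `R` of
`B` makes `|R : A ∩ R|` divide it, so this index is `1` and `R ≤ A`. -/
lemma IsSPermutable.isSubnormal_of_sup_eq [Finite G] {A B : Subgroup G} (hA : A.IsSPermutable)
    {p : ℕ} (hp : p.Prime) (P : Sylow p B) (hB : A ⊔ (P : Subgroup B).map B.subtype = B) :
    (A.subgroupOf B).IsSubnormal := by
  have := Fact.mk hp
  have hAB : A ≤ B := hB ▸ le_sup_left
  refine isSubnormal_of_forall_sylow_le hp fun q hq hqp R => ?_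
  have := Fact.mk hq
  have hperm := hA.permutesWith_map_subtype hAB hq R
  have h1 : A.relIndex ((R : Subgroup B).map B.subtype) ∣ A.relIndex B := by
    rw [← hperm.relIndex_sup, ← relIndex_mul_relIndex A _ B le_sup_left
      (sup_le hAB (map_subtype_le _))]
    exact dvd_mul_right _ _
  have h2 : A.relIndex B ∣ Nat.card P := by
    have := (hA.permutesWith_map_subtype hAB hp P).relIndex_sup
    rw [hB] at this
    rw [this]
    exact (relIndex_dvd_card _ _).trans (card_map_dvd _ _)
  have h3 : A.relIndex ((R : Subgroup B).map B.subtype) ∣ Nat.card R :=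
    (relIndex_dvd_card _ _).trans (card_map_dvd _ _)
  obtain ⟨m, hm⟩ := IsPGroup.iff_card.1 P.2
  obtain ⟨n, hn⟩ := IsPGroup.iff_card.1 R.2
  have hco : Nat.Coprime (Nat.card P) (Nat.card R) := by
    rw [hm, hn]
    exact Nat.Coprime.pow _ _ ((Nat.coprime_primes hp hq).2 (Ne.symm hqp))
  have h4 := Nat.eq_one_of_dvd_coprimes hco (h1.trans h2) h3
  rw [relIndex_eq_one, map_le_iff_le_comap] at h4
  exact h4

/-- **Kegel's theorem** for a pair of S-permutable subgroups. -/
lemma IsSPermutable.isSubnormal_of_le [Finite G] {A B : Subgroup G} (hA : A.IsSPermutable)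
    (hB : B.IsSPermutable) (hAB : A ≤ B) (hBs : B.IsSubnormal) : A.IsSubnormal := by
  induction hn : Nat.card B - Nat.card A using Nat.strong_induction_on generalizing A B with
  | _ n ih =>
    by_cases hN : B ≤ normalizer (A : Set G)
    · exact .step A B hAB hBs ((normal_subgroupOf_iff_le_normalizer hAB).2 hN)
    obtain ⟨p, hp, P, hP⟩ : ∃ p, p.Prime ∧ ∃ P : Sylow p B,
        ¬ (P : Subgroup B).map B.subtype ≤ normalizer (A : Set G) := by
      by_contra! hcon
      refine hN (subgroupOf_eq_top.1 (eq_top_of_forall_exists_sylow_le fun p hp => ?_))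
      obtain ⟨P⟩ : Nonempty (Sylow p B) := inferInstance
      exact ⟨P, map_le_iff_le_comap.1 (hcon p hp P)⟩
    obtain ⟨x, hxP, hx⟩ := SetLike.not_le_iff_exists.1 hP
    have hxB : x ∈ B := map_subtype_le _ hxP
    have hsup := hA.sup (hA.smul x)
    have hle : MulAut.conj x • A ≤ B := conj_smul_le_of_le hAB ⟨x, hxB⟩
    have hlt : A < A ⊔ MulAut.conj x • A := by
      refine lt_of_le_of_ne le_sup_left fun h => hx ?_
      rw [mem_normalizer_iff_conj_smul_le]
      exact sup_eq_left.1 h.symm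
    have card_lt {C D : Subgroup G} (h : C < D) : Nat.card C < Nat.card D :=
      Set.ncard_lt_ncard (s := (C : Set G)) (t := (D : Set G)) h
    -- Either `A` and its conjugate by `x ∈ P` generate `B`, so that `A` and `P` do too, or their
    -- join is S-permutable and strictly between, and the induction applies to both gaps.
    rcases (sup_le hAB hle).eq_or_lt with heq | hltB
    · have hAP : A ⊔ (P : Subgroup B).map B.subtype = B := by
        refine le_antisymm (sup_le hAB (map_subtype_le _)) ?_
        conv_lhs => rw [← heq]
        exact sup_le le_sup_left
          (conj_smul_le_of_le le_sup_left ⟨x, le_sup_right (a := A) hxP⟩)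
      exact .trans hAB (hA.isSubnormal_of_sup_eq hp P hAP) hBs
    · have h1 := card_lt hlt
      have h2 := card_lt hltB
      exact ih _ (by omega) hA hsup le_sup_left
        (ih _ (by omega) hsup hB hltB.le hBs rfl) rfl

/-- **Kegel's theorem**: an S-permutable subgroup of a finite group is subnormal. -/
theorem IsSPermutable.isSubnormal [Finite G] {A : Subgroup G} (hA : A.IsSPermutable) :
    A.IsSubnormal := by
  refine hA.isSubnormal_of_le (B := ⊤) (fun p hp P => ?_) le_top .top
  rw [permutesWith_iff]
  exact fun a _ b hb => ⟨b * a, mem_top _, 1, one_mem _, by simp⟩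

/-! ### Normal `σ`-subgroups above subnormal ones. -/

/-- A subnormal `σ`-subgroup lies in a normal `σ`-subgroup. -/
theorem IsSubnormal.exists_normal_ge [Finite G] {A : Subgroup G} (hA : A.IsSubnormal) (σ : Set ℕ)
    (hσ : ∀ p, p.Prime → p ∣ Nat.card A → p ∈ σ) :
    ∃ N : Subgroup G, N.Normal ∧ A ≤ N ∧ ∀ p, p.Prime → p ∣ Nat.card N → p ∈ σ := by
  -- Generalised to a normal `σ`-subgroup `C` of `A`, so that `C` can be enlarged while climbing the
  -- subnormal chain.
  suffices H : ∀ C : Subgroup G, C ≤ A → A ≤ normalizer (C : Set G) →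
      (∀ p, p.Prime → p ∣ Nat.card C → p ∈ σ) →
      ∃ N : Subgroup G, N.Normal ∧ C ≤ N ∧ ∀ p, p.Prime → p ∣ Nat.card N → p ∈ σ from
    H A le_rfl le_normalizer hσ
  clear hσ
  induction hA with
  | top => exact fun C _ hC hσ => ⟨C, normalizer_eq_top_iff.1 (top_le_iff.1 hC), le_rfl, hσ⟩
  | step H K hHK _ hN ih =>
    intro C hCH hHC hσ
    rw [normal_subgroupOf_iff_le_normalizer hHK] at hN
    let S : Set (Subgroup G) := {D | D ≤ H ∧ H ≤ normalizer (D : Set G) ∧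
      ∀ p, p.Prime → p ∣ Nat.card D → p ∈ σ}
    have hsup : ∀ D ∈ S, ∀ E ∈ S, D ⊔ E ∈ S := by
      intro D hD E hE
      refine ⟨sup_le hD.1 hE.1, fun h hh => ?_, fun p hp hpd => ?_⟩
      · rw [mem_normalizer_iff_conj_smul_eq, smul_sup,
          mem_normalizer_iff_conj_smul_eq.1 (hD.2.1 hh),
          mem_normalizer_iff_conj_smul_eq.1 (hE.2.1 hh)]
      · have hperm : PermutesWith D E := by
          rw [permutesWith_iff]
          intro a ha b hb
          exact ⟨b * a * b⁻¹, (mem_normalizer_iff.1 (hD.2.1 (hE.1 hb)) a).1 ha, b, hb, by group⟩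
        have hcard : Nat.card (D ⊔ E : Subgroup G) = Nat.card D * D.relIndex E := by
          rw [← hperm.relIndex_sup, ← relIndex_bot_left, ← relIndex_bot_left,
            relIndex_mul_relIndex _ _ _ bot_le le_sup_left]
        rw [hcard, hp.dvd_mul] at hpd
        rcases hpd with h | h
        · exact hD.2.2 p hp h
        · exact hE.2.2 p hp (h.trans (relIndex_dvd_card _ _))
    obtain ⟨D, hCD, hD⟩ := (Set.toFinite S).exists_le_maximal (a := C) ⟨hCH, hHC, hσ⟩
    -- `D` is the largest normal `σ`-subgroup of `H`. Conjugation by `K` preserves `H`, hence the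
    -- family `S`, hence `D`, so `D` is normal in `K`.
    have hDmax : ∀ E ∈ S, E ≤ D := fun E hE =>
      le_sup_right.trans (hD.2 (hsup D hD.1 E hE) le_sup_left)
    obtain ⟨N, hN1, hN2, hN3⟩ := ih D (hD.1.1.trans hHK) (fun k hk => by
      rw [mem_normalizer_iff_conj_smul_le]
      have hkH : MulAut.conj k • H = H := mem_normalizer_iff_conj_smul_eq.1 (hN hk)
      refine hDmax _ ⟨?_, fun h hh => ?_, ?_⟩
      · rw [← hkH]
        exact pointwise_smul_le_pointwise_smul_iff.2 hD.1.1
      · obtain ⟨h', hh', rfl⟩ : h ∈ MulAut.conj k • H := hkH.symm ▸ hh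
        have := mem_normalizer_iff_conj_smul_eq.1 (hD.1.2.1 hh')
        rw [mem_normalizer_iff_conj_smul_eq, smul_smul]
        change (MulAut.conj (k * h' * k⁻¹) * MulAut.conj k) • D = _
        rw [← map_mul, inv_mul_cancel_right, map_mul, mul_smul, this]
      · rw [Nat.card_congr (equivSMul (MulAut.conj k) D).symm.toEquiv]
        exact hD.1.2.2) hD.1.2.2
    exact ⟨N, hN1, hCD.trans hN2, hN3⟩

end Subgroup

/-! ### Arithmetic of `π`-numbers. -/

lemma isPiNumber_iff {π : Set ℕ} {n : ℕ} :
    IsPiNumber π n ↔ ∀ p, p.Prime → p ∣ n → p ∈ π := by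
  refine ⟨fun h p hp hpn => ?_, fun h p hp => ?_⟩
  · by_contra hpπ
    exact hp.one_lt.ne' (Nat.eq_one_of_dvd_coprimes (h p ⟨hp, hpπ⟩) hpn dvd_rfl)
  · exact ((hp.1.coprime_iff_not_dvd).2 fun hpn => hp.2 (h p hp.1 hpn)).symm

lemma isPiNumber_primeCompl_iff {π : Set ℕ} {n : ℕ} :
    IsPiNumber (primeCompl π) n ↔ ∀ p, p.Prime → p ∣ n → p ∉ π := by
  rw [isPiNumber_iff]
  exact ⟨fun h p hp hpn => (h p hp hpn).2, fun h p hp hpn => ⟨hp, h p hp hpn⟩⟩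

lemma IsPiNumber.of_dvd {π : Set ℕ} {m n : ℕ} (hn : IsPiNumber π n) (h : m ∣ n) :
    IsPiNumber π m :=
  fun p hp => (hn p hp).coprime_dvd_left h

lemma IsPiNumber.mul {π : Set ℕ} {m n : ℕ} (hm : IsPiNumber π m) (hn : IsPiNumber π n) :
    IsPiNumber π (m * n) :=
  fun p hp => (hm p hp).mul_left (hn p hp)

lemma IsPiNumber.coprime {π : Set ℕ} {m n : ℕ} (hm : IsPiNumber (primeCompl π) m)
    (hn : IsPiNumber π n) : m.Coprime n :=
  Nat.coprime_of_dvd fun p hp hpm hpn =>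
    isPiNumber_primeCompl_iff.1 hm p hp hpm (isPiNumber_iff.1 hn p hp hpn)

/-! ### Wielandt's conjugacy theorem for nilpotent Hall subgroups. -/

namespace Group.IsNilpotent

variable {G : Type*} [Group G] [Finite G] [Group.IsNilpotent G]

lemma mem_sylow_of_pow_eq_one {p k : ℕ} [Fact p.Prime] {x : G} (hx : x ^ p ^ k = 1)
    (P : Sylow p G) : x ∈ P := by
  have hz : IsPGroup p (Subgroup.zpowers x) := by
    rintro ⟨_, m, rfl⟩
    refine ⟨k, Subtype.ext ?_⟩
    change (x ^ m) ^ p ^ k = 1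
    rw [← zpow_natCast, ← zpow_mul, mul_comm, zpow_mul, zpow_natCast, hx, one_zpow]
  obtain ⟨Q, hQ⟩ := hz.exists_le_sylow
  have := Sylow.unique_of_normal P inferInstance
  rw [Subsingleton.elim P Q]
  exact hQ (Subgroup.mem_zpowers x)

lemma commute_of_pow_eq_one {p q k l : ℕ} (hp : p.Prime) (hq : q.Prime) (hpq : p ≠ q) {x y : G}
    (hx : x ^ p ^ k = 1) (hy : y ^ q ^ l = 1) : Commute x y := by
  have := Fact.mk hp
  have := Fact.mk hq
  obtain ⟨P⟩ : Nonempty (Sylow p G) := inferInstance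
  obtain ⟨Q⟩ : Nonempty (Sylow q G) := inferInstance
  exact Subgroup.commute_of_normal_of_disjoint (P : Subgroup G) Q inferInstance inferInstance
    (P.2.disjoint_of_ne p q hpq _ _ Q.2) x y (mem_sylow_of_pow_eq_one hx P)
    (mem_sylow_of_pow_eq_one hy Q)

end Group.IsNilpotent

namespace IsHallPiSubgroup

open Subgroup

variable {G : Type*} [Group G] {π : Set ℕ} {H K : Subgroup G}

lemma smul (hH : IsHallPiSubgroup π H) (g : G) : IsHallPiSubgroup π (MulAut.conj g • H) := by
  refine ⟨?_, ?_⟩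
  · rw [Nat.card_congr (equivSMul (MulAut.conj g) H).symm.toEquiv]
    exact hH.1
  · have : (MulAut.conj g • H).index = H.index := index_map_equiv H (MulAut.conj g)
    rw [this]
    exact hH.2

variable [Finite G]

lemma exists_sylow_le (hH : IsHallPiSubgroup π H) {p : ℕ} (hp : p.Prime) (hpπ : p ∈ π) :
    ∃ P : Sylow p G, (P : Subgroup G) ≤ H := by
  have := Fact.mk hp
  obtain ⟨Q⟩ : Nonempty (Sylow p H) := inferInstance
  refine ⟨(Q.2.map H.subtype).toSylow ?_, map_subtype_le _⟩
  rw [index_map_subtype, hp.dvd_mul]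
  rintro (h | h)
  · exact Q.not_dvd_index h
  · exact isPiNumber_primeCompl_iff.1 hH.2 p hp h hpπ

/-- **Wielandt's theorem**, containment form up to conjugacy. -/
lemma exists_le_conj_of_isNilpotent (hH : IsHallPiSubgroup π H) (hK : IsHallPiSubgroup π K)
    (hHn : Group.IsNilpotent H) (hKn : Group.IsNilpotent K) :
    ∃ g : G, H ≤ MulAut.conj g • K := by
  -- Induction on the set of primes: one conjugate of `K` captures all `p`-elements of `H` for `p ∈
  -- S`.
  have main : ∀ S : Finset ℕ, (∀ p ∈ S, p.Prime ∧ p ∈ π) →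
      ∃ g : G, ∀ p ∈ S, ∀ x ∈ H, ∀ k, x ^ p ^ k = 1 → x ∈ MulAut.conj g • K := by
    intro S
    induction S using Finset.induction with
    | empty => exact fun _ => ⟨1, by simp⟩
    | insert q S hqS ih =>
      intro hS
      obtain ⟨g, hg⟩ := ih fun p hp => hS p (Finset.mem_insert_of_mem hp)
      obtain ⟨hq, hqπ⟩ := hS q (Finset.mem_insert_self q S)
      have := Fact.mk hq
      have hKn' : Group.IsNilpotent (MulAut.conj g • K : Subgroup G) :=
        Group.nilpotent_of_mulEquiv (equivSMul (MulAut.conj g) K)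
      -- By nilpotency, Sylow `q`-subgroups of both `H` and the current conjugate of `K` centralise
      -- `E`. They are Sylow in `G`, so an element of the centraliser conjugates one to the other
      -- without disturbing what is already captured.
      let E : Set G := {x | x ∈ H ∧ ∃ p ∈ S, ∃ k, x ^ p ^ k = 1}
      have hcent : ∀ L : Subgroup G, Group.IsNilpotent L → E ⊆ L → ∀ P : Sylow q G,
          (P : Subgroup G) ≤ L → (P : Subgroup G) ≤ centralizer E := by
        intro L hL hEL P hPL y hy
        rw [mem_centralizer_iff]
        intro x hx
        obtain ⟨p, hp, k, hk⟩ := hx.2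
        obtain ⟨l, hl⟩ := P.2 ⟨y, hy⟩
        have hl' : y ^ q ^ l = 1 := congrArg Subtype.val hl
        have hpq : p ≠ q := fun h => hqS (h ▸ hp)
        have := Group.IsNilpotent.commute_of_pow_eq_one
          (hS p (Finset.mem_insert_of_mem hp)).1 hq hpq (x := (⟨x, hEL hx⟩ : L))
          (y := ⟨y, hPL hy⟩) (k := k) (l := l) (Subtype.ext hk)
          (Subtype.ext hl')
        exact congrArg Subtype.val this.eq
      obtain ⟨P, hP⟩ := hH.exists_sylow_le hq hqπ
      obtain ⟨Q, hQ⟩ := (hK.smul g).exists_sylow_le hq hqπ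
      have hPC := hcent H hHn (fun x hx => hx.1) P hP
      have hQC := hcent _ hKn' (fun x hx => by
        obtain ⟨p, hp, k, hk⟩ := hx.2
        exact hg p hp x hx.1 k hk) Q hQ
      obtain ⟨c, hc⟩ := MulAction.exists_smul_eq (centralizer E) (Q.subtype hQC) (P.subtype hPC)
      rw [Sylow.smul_subtype] at hc
      have hc' : (c : G) • Q = P := Sylow.subtype_injective hc
      refine ⟨c * g, fun p hp x hx k hk => ?_⟩
      rw [map_mul, mul_smul]
      rcases Finset.mem_insert.1 hp with rfl | hp
      · have hxP : x ∈ P := Group.IsNilpotent.mem_sylow_of_pow_eq_one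
          (x := (⟨x, hx⟩ : H)) (Subtype.ext hk) (P.subtype hP)
        rw [← hc'] at hxP
        exact pointwise_smul_le_pointwise_smul_iff (a := MulAut.conj (c : G)).2 hQ hxP
      · rw [mem_pointwise_smul_iff_inv_smul_mem, ← map_inv]
        have hcx : x * c = c * x := mem_centralizer_iff.1 c.2 x ⟨hx, p, hp, k, hk⟩
        have : MulAut.conj (c : G)⁻¹ • x = x := by
          simp [MulAut.smul_def, mul_assoc, hcx]
        rw [this]
        exact hg p hp x hx k hk
  obtain ⟨g, hg⟩ := main (Nat.card H).primeFactors fun p hp =>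
    ⟨Nat.prime_of_mem_primeFactors hp,
      isPiNumber_iff.1 hH.1 p (Nat.prime_of_mem_primeFactors hp) (Nat.dvd_of_mem_primeFactors hp)⟩
  refine ⟨g, subgroupOf_eq_top.1 (eq_top_of_forall_exists_sylow_le fun p hp => ?_)⟩
  have := Fact.mk hp
  obtain ⟨P⟩ : Nonempty (Sylow p H) := inferInstance
  refine ⟨P, fun x hx => ?_⟩
  by_cases hpd : p ∣ Nat.card H
  · obtain ⟨k, hk⟩ := P.2 ⟨x, hx⟩
    exact hg p (Nat.mem_primeFactors.2 ⟨hp, hpd, Nat.card_pos.ne'⟩) x x.2 k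
      (congrArg (fun y : (P : Subgroup H) => ((y : H) : G)) hk)
  · have hbot : (P : Subgroup H) = ⊥ := by
      rw [← card_eq_one]
      obtain ⟨n, hn⟩ := IsPGroup.iff_card.1 P.2
      rcases n with _ | n
      · simpa using hn
      · exact absurd ((hn ▸ dvd_pow_self p n.succ_ne_zero).trans (card_subgroup_dvd_card _)) hpd
    have : x = 1 := by
      rw [← mem_bot, ← hbot]; exact hx
    rw [this]
    exact one_mem _

/-- **Wielandt's theorem**: nilpotent Hall `π`-subgroups are conjugate. -/
theorem exists_conj_eq_of_isNilpotent (hH : IsHallPiSubgroup π H) (hK : IsHallPiSubgroup π K)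
    (hHn : Group.IsNilpotent H) (hKn : Group.IsNilpotent K) :
    ∃ g : G, MulAut.conj g • K = H := by
  obtain ⟨g, hg⟩ := hH.exists_le_conj_of_isNilpotent hK hHn hKn
  obtain ⟨h, hh⟩ := hK.exists_le_conj_of_isNilpotent hH hKn hHn
  refine ⟨g, (eq_of_le_of_card_ge hg ?_).symm⟩
  rw [Nat.card_congr (equivSMul (MulAut.conj g) K).symm.toEquiv,
    Nat.card_congr (equivSMul (MulAut.conj h) H).toEquiv]
  exact card_le_of_le hh

end IsHallPiSubgroup

/-! ### Extensions and soluble Hall subgroups. -/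

section

open Subgroup

variable {G : Type*} [Group G] {π : Set ℕ}

lemma IsESPiGroup.of_subgroup {M : Subgroup G} (hM : IsPiNumber (primeCompl π) M.index)
    (h : IsESPiGroup π M) : IsESPiGroup π G := by
  obtain ⟨H, ⟨hc, hi⟩, hs⟩ := h
  let e := H.equivMapOfInjective M.subtype M.subtype_injective
  refine ⟨H.map M.subtype, ⟨?_, ?_⟩, Group.isSolvable_of_surjective (f := e.toMonoidHom) e.surjective⟩
  · rwa [← Nat.card_congr e.toEquiv]
  · rw [index_map_subtype]
    exact hi.mul hM

/-- By Schur–Zassenhaus the kernel has a complement, which embeds in `Γ`. -/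
lemma IsESPiGroup.of_ker_of_solvable {Γ : Type*} [Group Γ] [Finite Γ] (f : G →* Γ)
    (hΓs : Group.IsSolvable Γ) (hΓ : IsPiNumber π (Nat.card Γ))
    (hker : IsPiNumber (primeCompl π) (Nat.card f.ker)) : IsESPiGroup π G := by
  have hindex : IsPiNumber π f.ker.index := by
    rw [index_ker]
    exact hΓ.of_dvd (card_subgroup_dvd_card _)
  obtain ⟨C, hC⟩ := exists_left_complement'_of_coprime (hker.coprime hindex)
  refine ⟨C, ⟨?_, ?_⟩, ?_⟩
  · rwa [← hC.index_eq_card]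
  · rwa [hC.symm.index_eq_card]
  · refine Group.isSolvable_of_isSolvable_injective (f := f.comp C.subtype) ?_
    rw [← MonoidHom.ker_eq_bot_iff, ← MonoidHom.comap_ker, ← subgroupOf, subgroupOf_eq_bot]
    exact hC.disjoint.symm

lemma IsESPiGroup.of_quotient_of_solvable {Y : Subgroup G} [Y.Normal] (hYs : Group.IsSolvable Y)
    (hY : IsPiNumber π (Nat.card Y)) (h : IsESPiGroup π (G ⧸ Y)) : IsESPiGroup π G := by
  obtain ⟨C, ⟨hc, hi⟩, hs⟩ := h
  let f := (QuotientGroup.mk' Y).subgroupComap C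
  have hYC : Y ≤ C.comap (QuotientGroup.mk' Y) := by
    intro x hx
    rw [mem_comap, QuotientGroup.mk'_apply, (QuotientGroup.eq_one_iff x).2 hx]
    exact one_mem C
  refine ⟨C.comap (QuotientGroup.mk' Y), ⟨?_, ?_⟩, ?_⟩
  · rw [← relIndex_bot_left, ← relIndex_mul_relIndex ⊥ Y _ bot_le hYC, relIndex_bot_left]
    refine hY.mul ?_
    have := relIndex_ker (C.comap (QuotientGroup.mk' Y)) (QuotientGroup.mk' Y)
    rw [QuotientGroup.ker_mk', map_comap_eq_self_of_surjective (QuotientGroup.mk'_surjective Y)]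
      at this
    rwa [this]
  · rwa [index_comap_of_surjective _ (QuotientGroup.mk'_surjective Y)]
  · refine Group.isSolvable_of_ker_le_range (inclusion hYC) f ?_
    intro x hx
    have : QuotientGroup.mk' Y x = 1 := congrArg Subtype.val hx
    exact ⟨⟨x, (QuotientGroup.eq_one_iff _).1 this⟩, rfl⟩

/-- An extension of an `E^N_π`-group by an `E^S_π`-group is an `E^S_π`-group. -/
theorem IsESPiGroup.of_isENPiGroup_ker [Finite G] {Γ : Type*} [Group Γ] [Finite Γ] (φ : G →* Γ)
    (hφ : Function.Surjective φ) (hker : IsENPiGroup π φ.ker) (hΓ : IsESPiGroup π Γ) :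
    IsESPiGroup π G := by
  set X := φ.ker with hX
  obtain ⟨Y₀, hY₀, hYn⟩ := hker
  obtain ⟨S, ⟨hSc, hSi⟩, hSs⟩ := hΓ
  let Y : Subgroup G := Y₀.map X.subtype
  let e : Y₀ ≃* Y := Y₀.equivMapOfInjective X.subtype X.subtype_injective
  have hYX : Y ≤ X := map_subtype_le Y₀
  have hY₀Y : Y.subgroupOf X = Y₀ := comap_map_eq_self_of_injective X.subtype_injective Y₀
  have hYcard : IsPiNumber π (Nat.card Y) := by
    rw [← Nat.card_congr e.toEquiv]; exact hY₀.1
  have hYrel : IsPiNumber (primeCompl π) (Y.relIndex X) := by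
    rw [relIndex, hY₀Y]; exact hY₀.2
  have : Group.IsNilpotent Y := Group.nilpotent_of_mulEquiv e
  -- Frattini argument: conjugates of `Y` under `G` are nilpotent Hall subgroups of `X`, hence
  -- already conjugate under `X`.
  have hfrattini : ∀ g : G, ∃ x ∈ X, ∃ n ∈ normalizer (Y : Set G), g = x * n := by
    intro g
    have hconj : MulAut.conj g • Y ≤ X := by
      rw [← Normal.conj_smul_eq_self g X]
      exact pointwise_smul_le_pointwise_smul_iff.2 hYX
    let Z : Subgroup X := (MulAut.conj g • Y).subgroupOf X
    let eZ : Z ≃* Y := (subgroupOfEquivOfLe hconj).trans (equivSMul (MulAut.conj g) Y).symm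
    have hZ : IsHallPiSubgroup π Z := by
      refine ⟨by rwa [Nat.card_congr eZ.toEquiv], ?_⟩
      have : Z.index = Y.relIndex X := by
        have := relIndex_pointwise_smul (MulAut.conj g) Y X
        rwa [Normal.conj_smul_eq_self g X] at this
      rwa [this]
    have hZn : Group.IsNilpotent Z := Group.nilpotent_of_mulEquiv eZ.symm
    obtain ⟨x, hx⟩ := hZ.exists_conj_eq_of_isNilpotent hY₀ hZn hYn
    have hx' : MulAut.conj (x : G) • Y = MulAut.conj g • Y := by
      have h1 : (Z.map X.subtype) = MulAut.conj g • Y := by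
        rw [subgroupOf_map_subtype, inf_eq_left.2 hconj]
      rw [← h1, ← hx, ← hY₀Y, conj_smul_subgroupOf hYX, subgroupOf_map_subtype,
        inf_eq_left.2 (conj_smul_le_of_le hYX x)]
    refine ⟨x, x.2, (x : G)⁻¹ * g, ?_, by group⟩
    rw [mem_normalizer_iff_conj_smul_eq, map_mul, mul_smul, ← hx', map_inv, inv_smul_smul]
  let M : Subgroup G := S.comap φ
  have hXM : X ≤ M := by
    rw [hX, ← MonoidHom.comap_bot]
    exact comap_mono bot_le
  let N : Subgroup G := normalizer (Y : Set G) ⊓ M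
  have hYN : Y ≤ N := le_inf le_normalizer (hYX.trans hXM)
  have hNindex : IsPiNumber (primeCompl π) N.index := by
    -- By the Frattini factorisation, `|M : N|` is the index of the normaliser of `Y` relative to
    -- `X`, which divides the `π'`-number `|X : Y|`.
    rw [← relIndex_mul_index (inf_le_right : N ≤ M), inf_relIndex_right,
      index_comap_of_surjective _ hφ,
      ← relIndex_eq_of_forall_exists_mul hXM fun x _ => hfrattini x]
    exact (hYrel.of_dvd (relIndex_dvd_of_le_left X le_normalizer)).mul hSi
  refine IsESPiGroup.of_subgroup hNindex ?_
  let Y' := Y.subgroupOf N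
  have : Y'.Normal := (normal_subgroupOf_iff_le_normalizer hYN).2 inf_le_left
  let e' : Y' ≃* Y := subgroupOfEquivOfLe hYN
  have hY's : Group.IsNilpotent Y' := Group.nilpotent_of_mulEquiv e'.symm
  refine IsESPiGroup.of_quotient_of_solvable (Y := Y') inferInstance
    (by rwa [Nat.card_congr e'.toEquiv]) ?_
  let f : N →* S := (φ.comp N.subtype).codRestrict S fun x => x.2.2
  have hfker : f.ker = X.subgroupOf N := by
    ext x
    exact Subtype.ext_iff
  have hY'f : Y' ≤ f.ker := hfker ▸ comap_mono hYX
  -- `N / Y` maps to the soluble `π`-group `S` with kernel `(X ∩ N) / Y`, whose order divides `|X :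
  -- Y|`.
  refine IsESPiGroup.of_ker_of_solvable (QuotientGroup.lift Y' f hY'f) hSs hSc ?_
  have hcard : Nat.card (QuotientGroup.lift Y' f hY'f).ker = Y.relIndex (X ⊓ N) := by
    rw [QuotientGroup.ker_lift, ← relIndex_ker, QuotientGroup.ker_mk', hfker, ← inf_subgroupOf_right,
      relIndex_subgroupOf inf_le_right]
  rw [hcard]
  refine hYrel.of_dvd ?_
  rw [← relIndex_mul_relIndex Y (X ⊓ N) X (le_inf hYX hYN) inf_le_left]
  exact dvd_mul_right _ _

lemma IsENPiGroup.of_unique_prime_dvd [Finite G] (h : ∀ p ∈ π, ∀ q ∈ π, p.Prime → q.Prime →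
    p ∣ Nat.card G → q ∣ Nat.card G → p = q) : IsENPiGroup π G := by
  by_cases hex : ∃ p ∈ π, p.Prime ∧ p ∣ Nat.card G
  · obtain ⟨p, hpπ, hp, hpd⟩ := hex
    have := Fact.mk hp
    obtain ⟨P⟩ : Nonempty (Sylow p G) := inferInstance
    refine ⟨P, ⟨isPiNumber_iff.2 fun q hq hqd => ?_, isPiNumber_primeCompl_iff.2
      fun q hq hqd hqπ => ?_⟩, P.2.isNilpotent⟩
    · obtain ⟨n, hn⟩ := IsPGroup.iff_card.1 P.2
      have : q = p := (Nat.prime_dvd_prime_iff_eq hq hp).1 (hq.dvd_of_dvd_pow (hn ▸ hqd))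
      exact this ▸ hpπ
    · rw [h q hqπ p hpπ hq hp (hqd.trans (index_dvd_card _)) hpd] at hqd
      exact P.not_dvd_index hqd
  · push Not at hex
    refine ⟨⊥, ⟨isPiNumber_iff.2 fun q hq hqd => ?_, isPiNumber_primeCompl_iff.2
      fun q hq hqd hqπ => ?_⟩, inferInstance⟩
    · rw [card_bot] at hqd
      exact absurd hqd hq.not_dvd_one
    · rw [index_bot] at hqd
      exact hex q hqπ hq hqd

/-! ### Čunihin's theorem for subnormal series. -/

lemma Subgroup.relIndex_map_dvd {G' : Type*} [Group G'] (f : G →* G') (H K : Subgroup G) : (H.map f).relIndex (K.map f) ∣ H.relIndex K := by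
  rw [relIndex_map_map, ← relIndex_eq_of_forall_exists_mul (B := K) le_sup_left]
  · exact relIndex_dvd_of_le_left K le_sup_left
  · intro x hx
    obtain ⟨k, hk, n, hn, rfl⟩ := mem_sup_of_normal_right.1 hx
    exact ⟨k, hk, n, le_sup_right (a := H) hn, rfl⟩

/-- A form of **Čunihin's theorem**: a group with a series of subnormal subgroups, each of whose
indices is divisible by at most one prime in `π`, has a soluble Hall `π`-subgroup. -/
theorem IsESPiGroup.of_subnormal_series {G : Type*} [Group G] [Finite G] (t : ℕ)
    (K : ℕ → Subgroup G) (hK0 : K 0 = ⊥) (hKt : K t = ⊤) (hmono : ∀ i < t, K i ≤ K (i + 1))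
    (hsub : ∀ i ≤ t, (K i).IsSubnormal)
    (hindex : ∀ i < t, ∀ p ∈ π, ∀ q ∈ π, p.Prime → q.Prime → p ∣ (K i).relIndex (K (i + 1)) →
      q ∣ (K i).relIndex (K (i + 1)) → p = q) : IsESPiGroup π G := by
  induction t generalizing G with
  | zero =>
    refine ⟨⊤, ⟨isPiNumber_iff.2 fun q hq hqd => ?_, isPiNumber_primeCompl_iff.2
      fun q hq hqd hqπ => ?_⟩, ?_⟩
    · rw [← hKt, hK0, card_bot] at hqd
      exact absurd hqd hq.not_dvd_one
    · rw [index_top] at hqd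
      exact hq.not_dvd_one hqd
    · rw [← hKt, hK0]
      infer_instance
  | succ t ih =>
    -- Here `σ` is `π'` together with the primes dividing `|K 1|`: `N` may acquire primes outside
    -- `π`, but still at most one inside.
    obtain ⟨N, hN, hKN, hNp⟩ := (hsub 1 (by omega)).exists_normal_ge
      {p | p ∈ π → p ∣ Nat.card (K 1)} fun p _ hpd _ => hpd
    have hcard : (K 0).relIndex (K 1) = Nat.card (K 1) := by rw [hK0, relIndex_bot_left]
    have hsurj := QuotientGroup.mk'_surjective N
    refine IsESPiGroup.of_isENPiGroup_ker (QuotientGroup.mk' N) hsurj ?_ ?_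
    · rw [QuotientGroup.ker_mk']
      refine IsENPiGroup.of_unique_prime_dvd fun p hpπ q hqπ hp hq hpd hqd => ?_
      refine hindex 0 (by omega) p hpπ q hqπ hp hq ?_ ?_
      · rw [zero_add, hcard]; exact hNp p hp hpd hpπ
      · rw [zero_add, hcard]; exact hNp q hq hqd hqπ
    · refine ih (fun i => (K (i + 1)).map (QuotientGroup.mk' N)) ?_ ?_ ?_ ?_ ?_
      · rwa [zero_add, Subgroup.map_eq_bot_iff, QuotientGroup.ker_mk']
      · rw [hKt, map_top_of_surjective _ hsurj]
      · exact fun i hi => map_mono (hmono (i + 1) (by omega))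
      · exact fun i hi => (hsub (i + 1) (by omega)).map hsurj
      · intro i hi p hpπ q hqπ hp hq hpd hqd
        have hd := relIndex_map_dvd (QuotientGroup.mk' N) (K (i + 1)) (K (i + 2))
        exact hindex (i + 1) (by omega) p hpπ q hqπ hp hq (hpd.trans hd) (hqd.trans hd)

end

/-! ### Passage to the image of `T` modulo `X`. -/

open Subgroup

lemma PermutesWith.subgroupOf {G : Type*} [Group G] {A L : Subgroup G} {Q : Subgroup L}
    (h : PermutesWith A (Q.map L.subtype)) : PermutesWith (A.subgroupOf L) Q := by
  rw [permutesWith_iff] at h ⊢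
  intro a ha b hb
  obtain ⟨a', ha', _, ⟨b', hb', rfl⟩, e⟩ := h a ha b (mem_map_of_mem _ hb)
  have hval : a' = ((b * a * b'⁻¹ : L) : G) := by
    push_cast
    exact eq_mul_inv_of_mul_eq e.symm
  exact ⟨b * a * b'⁻¹, mem_subgroupOf.2 (hval ▸ ha'), b', hb', by group⟩

lemma XPermutesWith.permutesWith_map {G Γ : Type*} [Group G] [Group Γ] {X : Set G}
    {A B : Subgroup G} (h : XPermutesWith X A B) (f : G →* Γ) (hf : ∀ x ∈ X, f x = 1) :
    PermutesWith (A.map f) (B.map f) := by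
  obtain ⟨x, hx, hperm⟩ := h
  have hB : (conjSubgroup B x).map f = B.map f := by
    rw [conjSubgroup, map_map]
    congr 1
    ext b
    simp [hf x hx]
  exact hB ▸ hperm.map f

theorem theorem5p2 {G : Type*} [Group G] [Finite G]
    (π : Set ℕ) (hπ : ∀ p ∈ π, p.Prime) (hπne : π.Nonempty)
    (X : Subgroup G) (hXnormal : X.Normal) (hX : IsENPiGroup π X)
    -- the subgroup series `1 = H₀ < H₁ ≤ ⋯ ≤ H_t = G`
    (t : ℕ) (ht : 1 ≤ t) (H : ℕ → Subgroup G)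
    (hH0 : H 0 = ⊥) (hH1 : H 0 < H 1) (hHmono : ∀ i, i < t → H i ≤ H (i + 1)) (hHt : H t = ⊤)
    -- each index `|H_{i+1} : H_i|` is divisible by at most one prime in `π`
    (hindex : ∀ i, i < t → ∀ p ∈ π, ∀ q ∈ π,
      p ∣ (H i).relIndex (H (i + 1)) → q ∣ (H i).relIndex (H (i + 1)) → p = q)
    (T : Subgroup G) (hT : (H 1 : Set G) * (T : Set G) = Set.univ)
    (hTindex : IsPiNumber (primeCompl π) T.index)
    -- each `H_i` is `X`-permutable with each Sylow subgroup of `T`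
    (hperm : ∀ i, 1 ≤ i → i ≤ t → ∀ p : ℕ, p.Prime → ∀ P : Sylow p T,
      XPermutesWith (X : Set G) (H i) ((P : Subgroup T).map T.subtype)) :
    IsESPiGroup π G := by
  let f := QuotientGroup.mk' X
  have hf : Function.Surjective f := QuotientGroup.mk'_surjective X
  refine IsESPiGroup.of_isENPiGroup_ker f hf ((QuotientGroup.ker_mk' X).symm ▸ hX) ?_
  refine IsESPiGroup.of_subgroup (M := T.map f) (hTindex.of_dvd (index_map_dvd T hf)) ?_
  have hH1le : ∀ i, i + 1 ≤ t → H 1 ≤ H (i + 1) := by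
    intro i
    induction i with
    | zero => exact fun _ => le_rfl
    | succ i ih => exact fun hi => (ih (by omega)).trans (hHmono _ (by omega))
  have hcover : ∀ y : G ⧸ X, ∃ s ∈ T.map f, ∃ a ∈ (H 1).map f, y = s * a := by
    intro y
    obtain ⟨g, rfl⟩ := hf y
    obtain ⟨h, hh, s, hs, e⟩ : g⁻¹ ∈ (H 1 : Set G) * (T : Set G) := hT ▸ Set.mem_univ _
    refine ⟨f s⁻¹, mem_map_of_mem f (inv_mem hs), f h⁻¹, mem_map_of_mem f (inv_mem hh), ?_⟩
    rw [← map_mul, ← mul_inv_rev]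
    exact congrArg f (inv_eq_iff_eq_inv.1 e.symm)
  -- The bottom index is treated separately: the factorisation argument for the others needs `H 1 ≤
  -- H i`, which fails at `i = 0`.
  let K : ℕ → Subgroup (T.map f)
    | 0 => ⊥
    | i + 1 => ((H (i + 1)).map f).subgroupOf (T.map f)
  have hdvd : ∀ i < t, (K i).relIndex (K (i + 1)) ∣ (H i).relIndex (H (i + 1)) := by
    rintro (_ | i) hi
    · have hcard : Nat.card (K 1) ∣ Nat.card (H 1) := by
        refine dvd_trans ?_ (card_map_dvd (H 1) f)
        exact card_comap_dvd_of_injective ((H 1).map f) (T.map f).subtype (subtype_injective _)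
      change (⊥ : Subgroup (T.map f)).relIndex (K 1) ∣ (H 0).relIndex (H 1)
      rwa [hH0, relIndex_bot_left, relIndex_bot_left]
    · change (((H (i + 1)).map f).subgroupOf (T.map f)).relIndex
        (((H (i + 2)).map f).subgroupOf (T.map f)) ∣ _
      rw [← inf_subgroupOf_right ((H (i + 2)).map f), relIndex_subgroupOf inf_le_right,
        relIndex_eq_of_forall_exists_mul (inf_le_left : _ ≤ (H (i + 2)).map f)]
      · exact relIndex_map_dvd f _ _
      · intro y hy
        obtain ⟨s, hs, a, ha, rfl⟩ := hcover y
        have ha1 := map_mono (f := f) (hH1le i (by omega)) ha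
        have ha2 := map_mono (f := f) (hH1le (i + 1) (by omega)) ha
        -- Since `a` lies in the image of `H 1`, and so in that of `H (i + 2)`, the factor `s` lies
        -- there as well.
        exact ⟨s, ⟨(Subgroup.mul_mem_cancel_right _ ha2).1 hy, hs⟩, a, ha1, rfl⟩
  refine IsESPiGroup.of_subnormal_series t K rfl ?_ ?_ ?_ fun i hi p hpπ q hqπ _ _ hpd hqd =>
    hindex i hi p hpπ q hqπ (hpd.trans (hdvd i hi)) (hqd.trans (hdvd i hi))
  · obtain ⟨s, rfl⟩ : ∃ s, t = s + 1 := ⟨t - 1, by omega⟩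
    change ((H (s + 1)).map f).subgroupOf (T.map f) = ⊤
    rw [hHt, subgroupOf_eq_top]
    exact map_mono le_top
  · rintro (_ | i) hi
    · exact bot_le
    · exact comap_mono (map_mono (hHmono _ hi))
  · rintro (_ | i) hi
    · exact .bot
    · refine IsSPermutable.isSubnormal fun p hp P => ?_
      have := Fact.mk hp
      -- Every Sylow subgroup of the image is the image of one of `T`, so the hypothesis on `T`
      -- covers them all.
      obtain ⟨Q, rfl⟩ := Sylow.mapSurjective_surjective (f.subgroupMap_surjective T) p P
      refine PermutesWith.subgroupOf ?_
      have h := (hperm (i + 1) (by omega) hi p hp Q).permutesWith_map f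
        fun x hx => (QuotientGroup.eq_one_iff x).2 hx
      rw [map_map] at h
      rw [Sylow.coe_mapSurjective, map_map]
      exact h
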